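/- Let $\Sigma=\{0,1,\dots,s-1\}$ be a finite ordered alphabet. Finite words are compared lexicographically, a proper prefix of a word being smaller than the word, and this order is extended to infinite words (and to comparing a finite with an infinite word) in the obvious way. A nonempty finite word is Lyndon if it is primitive (not of the form $u^e$ with $e\ge 2$) and lexicographically least among its conjugates; an infinite word $\mathbf y=a_0a_1a_2\cdots$ is Lyndon if it is lexicographically less than each of its suffixes $a_ja_{j+1}\cdots$ with $j\ge 1$. Every infinite word $\mathbf x$ over $\Sigma$ has exactly one of the following two kinds of factorization: an infinite Lyndon factorization $\mathbf x=w_1w_2w_3\cdots$ with all $w_i$ finite Lyndon words and $w_1\ge w_2\ge w_3\ge\cdots$, or a finite Lyndon factorization $\mathbf x=w_1w_2\cdots w_r\mathbf w$ with $r\ge 0$, all $w_i$ finite Lyndon words, $\mathbf w$ an infinite Lyndon word, and $w_1\ge w_2\ge\cdots\ge w_r\ge\mathbf w$. It is decidable which of the two occurs for an automatic sequence: there is an algorithm (a total computable function) that, given an integer $k\ge 2$ and the finite description (initial state, transition table, output table) of a deterministic finite automaton with output whose input alphabet is $\{0,\dots,k-1\}$ and whose outputs lie in $\Sigma$, decides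 whether the Lyndon factorization of the $k$-automatic sequence $\mathbf x=a_0a_1a_2\cdots$ computed by it is finite or infinite. Here $a_n$ is the output of the state reached from the initial state on reading the base-$k$ representation of $n$, most significant digit first and without leading zeros ($0$ being represented by the empty word). -/

import Mathlib

namespace LyndonAutomatic

/-! ### Finite words.  A word over an ordered alphabet `Γ` is a `List Γ`, and `<` and `≤` on lists
are the lexicographic order (a proper prefix of a word is smaller than the word). -/

section Words

variable {Γ : Type} [LinearOrder Γ]

/-- `w` is a power if `w = u ^ e` for some word `u` and some integer `e ≥ 2`. -/
def IsPower (w : List Γ) : Prop :=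
  ∃ (u : List Γ) (e : ℕ), 2 ≤ e ∧ w = (List.replicate e u).flatten

/-- A nonempty word is primitive if it is not a power. -/
def IsPrimitive (w : List Γ) : Prop :=
  w ≠ [] ∧ ¬ IsPower w

/-- A word is Lyndon if it is primitive and lexicographically least among all its conjugates
(the words `v ++ u` with `w = u ++ v`). -/
def IsLyndon (w : List Γ) : Prop :=
  IsPrimitive w ∧ ∀ u v : List Γ, w = u ++ v → w ≤ v ++ u

/-! ### Infinite words.  An infinite word over `Γ` is a function `ℕ → Γ`. -/

/-- Lexicographic order on infinite words. -/
def InfLt (x y : ℕ → Γ) : Prop :=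
  ∃ t, (∀ i < t, x i = y i) ∧ x t < y t

/-- The suffix `x[j..∞]` of the infinite word `x`. -/
def infSuffix (x : ℕ → Γ) (j : ℕ) : ℕ → Γ :=
  fun n => x (j + n)

/-- An infinite word is Lyndon if it is lexicographically less than all its suffixes
`x[j..∞]` with `j ≥ 1`. -/
def IsInfLyndon (x : ℕ → Γ) : Prop :=
  ∀ j, 1 ≤ j → InfLt x (infSuffix x j)

/-- The finite word `w` is lexicographically larger than the infinite word `y`.  An infinite word
is never a prefix of, or equal to, a finite word, so there must be a first position, inside `w`,
at which they differ, and `y` has the smaller letter there. -/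
def InfLtWord (y : ℕ → Γ) (w : List Γ) : Prop :=
  ∃ (t : ℕ) (ht : t < w.length), (∀ (i : ℕ) (hi : i < t), y i = w[i]) ∧ y t < w[t]

/-- The finite word `w` is a prefix of the infinite word `x`. -/
def IsPrefixOf (w : List Γ) (x : ℕ → Γ) : Prop :=
  ∀ (i : ℕ) (hi : i < w.length), x i = w[i]

/-- `x = w₀ w₁ w₂ ⋯` with each `wᵢ` a finite Lyndon word and `w₀ ≥ w₁ ≥ w₂ ≥ ⋯`.  (Lyndon words
are nonempty, so the prefix condition determines all of `x`.) -/
def HasInfiniteLyndonFactorization (x : ℕ → Γ) : Prop :=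
  ∃ w : ℕ → List Γ,
    (∀ i, IsLyndon (w i)) ∧
    (∀ i, w (i + 1) ≤ w i) ∧
    ∀ n, IsPrefixOf ((List.range n).map w).flatten x

/-- `x = w₁ w₂ ⋯ wᵣ y` with `r ≥ 0`, each `wᵢ` a finite Lyndon word, `y` an infinite Lyndon word,
and `w₁ ≥ w₂ ≥ ⋯ ≥ wᵣ ≥ y`. -/
def HasFiniteLyndonFactorization (x : ℕ → Γ) : Prop :=
  ∃ (ws : List (List Γ)) (y : ℕ → Γ),
    (∀ w ∈ ws, IsLyndon w) ∧
    IsInfLyndon y ∧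
    ws.Pairwise (fun u v => v ≤ u) ∧
    (∀ w ∈ ws, InfLtWord y w) ∧
    IsPrefixOf ws.flatten x ∧
    infSuffix x ws.flatten.length = y

end Words

/-! ### Automata with output -/

/-- A deterministic finite automaton with output: input alphabet `{0, …, k-1}`, state set
`{0, …, m-1}`, output alphabet `{0, …, s-1}`. -/
structure DFAO (k m s : ℕ) where
  /-- The transition function. -/
  step : Fin m → Fin k → Fin m
  /-- The initial state. -/
  start : Fin m
  /-- The output attached to each state. -/
  output : Fin m → Fin s

/-- `w` is the base-`k` representation of `n`, most significant digit first and without leading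
zeros (so that `0` is represented by the empty word). -/
def IsBaseRep {k : ℕ} (w : List (Fin k)) (n : ℕ) : Prop :=
  w.map Fin.val = (Nat.digits k n).reverse

/-- The state reached from the initial state on reading the word `w` from left to right. -/
def DFAO.eval {k m s : ℕ} (M : DFAO k m s) (w : List (Fin k)) : Fin m :=
  w.foldl M.step M.start

/-- The sequence `x` is the one computed by `M`: on input the base-`k` representation of `n`,
the automaton reaches a state with output `x n`. -/
def DFAO.Generates {k m s : ℕ} (M : DFAO k m s) (x : ℕ → Fin s) : Prop :=
  ∀ (n : ℕ) (w : List (Fin k)), IsBaseRep w n → M.output (M.eval w) = x n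

/-- Finite descriptions of automata: the base, the initial state, the transition table (one row
for each state) and the table of outputs. -/
abbrev Description : Type := ℕ × ℕ × List (List ℕ) × List ℕ

/-- The description of the automaton `M`, listing its tables entry by entry. -/
def DFAO.description {k m s : ℕ} (M : DFAO k m s) : Description :=
  (k, (M.start : ℕ),
    List.ofFn (fun q => List.ofFn (fun d => (M.step q d : ℕ))),
    List.ofFn (fun q => (M.output q : ℕ)))

end LyndonAutomatic

/-! Everything reduces to one property of the sequence: some suffix is an infinite Lyndon word, that
is, ∃ i, ∀ j > i, ∃ t, the suffixes at i and j first differ at distance t and the one at i is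
smaller there. A finite Lyndon factorization exists iff this holds
(`hasFiniteLyndonFactorization_iff`), an infinite one iff it fails
(`hasInfiniteLyndonFactorization_iff`). Both factorizations are built greedily from longest Lyndon
prefixes. Conversely, in an infinite factorization a suffix starting inside one factor is never
smaller than the suffix starting at a later factor.

The property is first-order over addition, order and an automatic sequence. Predicates with a finite
base-k kernel are closed under Boolean operations and projection, with explicit bounds on the kernel
size. A pumping argument (`IsAutomatic.exists_update_lt`) bounds the least witness of an existential
in terms of that size, so every quantifier can be bounded by a computable function and the property
is primitive recursive in the description of the automaton. -/

namespace LyndonAutomatic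

/-! ### Multidimensional automatic functions, by finiteness of the kernel -/

section Kernel

/-- Appending the least significant base-`k` digits `r` to the numbers `n`. -/
def appendDigits {V : Type} (k : ℕ) (n r : V → ℕ) : V → ℕ :=
  fun v => k * n v + r v

/-- `f` belongs to a family of at most `N` functions that is closed under fixing the least
significant base-`k` digits of all arguments. -/
def IsAutomatic {V α : Type} (k N : ℕ) (f : (V → ℕ) → α) : Prop :=
  ∃ (ι : Type) (_ : Fintype ι) (F : ι → (V → ℕ) → α), Fintype.card ι ≤ N ∧ (∃ i, F i = f) ∧
    ∀ i (r : V → ℕ), (∀ v, r v < k) → ∃ j, ∀ n, F i (appendDigits k n r) = F j n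

variable {V α β γ : Type} {k N N' : ℕ}

theorem IsAutomatic.map {f : (V → ℕ) → α} (hf : IsAutomatic k N f) (op : α → β) :
    IsAutomatic k N (fun n => op (f n)) := by
  obtain ⟨ι, _, F, hc, ⟨i, rfl⟩, hF⟩ := hf
  refine ⟨ι, inferInstance, fun i n => op (F i n), hc, ⟨i, rfl⟩, fun i r hr => ?_⟩
  obtain ⟨j, hj⟩ := hF i r hr
  exact ⟨j, fun n => congrArg op (hj n)⟩

theorem IsAutomatic.map₂ {f : (V → ℕ) → α} {g : (V → ℕ) → β} (hf : IsAutomatic k N f)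
    (hg : IsAutomatic k N' g) (op : α → β → γ) :
    IsAutomatic k (N * N') (fun n => op (f n) (g n)) := by
  obtain ⟨ι, _, F, hc, ⟨i, rfl⟩, hF⟩ := hf
  obtain ⟨κ, _, G, hc', ⟨i', rfl⟩, hG⟩ := hg
  refine ⟨ι × κ, inferInstance, fun p n => op (F p.1 n) (G p.2 n), ?_, ⟨(i, i'), rfl⟩,
    fun p r hr => ?_⟩
  · rw [Fintype.card_prod]; exact Nat.mul_le_mul hc hc'
  · obtain ⟨j, hj⟩ := hF p.1 r hr
    obtain ⟨j', hj'⟩ := hG p.2 r hr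
    exact ⟨(j, j'), fun n => congrArg₂ op (hj n) (hj' n)⟩

theorem isAutomatic_lt (u v : V) :
    IsAutomatic k 2 (fun n : V → ℕ => n u < n v) := by
  -- Appending a digit to both sides turns `<` or `≤` into one of the same two relations, according
  -- to how the new digits compare.
  refine ⟨Bool, inferInstance, fun b n => if b then n u ≤ n v else n u < n v, by simp,
    ⟨false, by simp⟩, fun b r hr => ?_⟩
  have hu := hr u
  have hv := hr v
  have key : ∀ n : V → ℕ, (n u < n v → k * n u + r u < k * n v) ∧
      (n v < n u → k * n v + r v < k * n u) := by
    intro n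
    constructor <;> intro h <;> nlinarith [Nat.mul_le_mul_left k (Nat.succ_le_of_lt h)]
  have heq : ∀ n : V → ℕ, n u = n v → k * n u = k * n v := fun n h => by rw [h]
  cases b
  · refine ⟨decide (r u < r v), fun n => ?_⟩
    have := key n
    have := heq n
    by_cases h : r u < r v
    · simp only [appendDigits, h, decide_true, if_true, eq_iff_iff]
      simp
      omega
    · simp only [appendDigits, h, decide_false, eq_iff_iff]
      simp
      omega
  · refine ⟨decide (r u ≤ r v), fun n => ?_⟩
    have := key n
    have := heq n
    by_cases h : r u ≤ r v
    · simp only [appendDigits, h, decide_true, if_true, eq_iff_iff]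
      omega
    · simp only [appendDigits, h, decide_false, eq_iff_iff]
      simp
      omega

/-- The `Fin 2` component is the carry: two digits plus a carry stay below 2k, so the next carry is
again 0 or 1. -/
theorem IsAutomatic.comp_add {x : ℕ → α} (hx : IsAutomatic k N (fun n : Unit → ℕ => x (n ())))
    (u v : V) : IsAutomatic k (N * 2) (fun n : V → ℕ => x (n u + n v)) := by
  obtain ⟨ι, _, F, hc, ⟨i, hi⟩, hF⟩ := hx
  refine ⟨ι × Fin 2, inferInstance, fun p n => F p.1 (fun _ => n u + n v + p.2), ?_,
    ⟨(i, 0), ?_⟩, fun p r hr => ?_⟩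
  · rw [Fintype.card_prod, Fintype.card_fin]; exact Nat.mul_le_mul_right _ hc
  · funext n; simp [hi]
  · have hu := hr u
    have hv := hr v
    have hp := p.2.isLt
    have hk : 0 < k := by omega
    obtain ⟨j, hj⟩ := hF p.1 (fun _ => (r u + r v + p.2) % k) (fun _ => Nat.mod_lt _ hk)
    refine ⟨(j, ⟨(r u + r v + p.2) / k, Nat.div_lt_of_lt_mul (by omega)⟩), fun n => ?_⟩
    refine Eq.trans ?_ (hj _)
    refine congrArg (F p.1) (funext fun w => ?_)
    have := Nat.div_add_mod (r u + r v + p.2) k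
    simp only [appendDigits]
    rw [Nat.mul_add, Nat.mul_add]
    omega

theorem exists_kernel_pow {ι : Type} {F : ι → (V → ℕ) → α}
    (hF : ∀ i (r : V → ℕ), (∀ v, r v < k) → ∃ j, ∀ n, F i (appendDigits k n r) = F j n)
    (i : ι) (p : ℕ) (r : V → ℕ) (hr : ∀ v, r v < k ^ p) :
    ∃ j, ∀ n, F i (appendDigits (k ^ p) n r) = F j n := by
  induction p generalizing r with
  | zero =>
    refine ⟨i, fun n => ?_⟩
    congr 1
    funext v
    have := hr v
    simp only [pow_zero] at this
    simp only [appendDigits, pow_zero]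
    omega
  | succ p ih =>
    rcases Nat.eq_zero_or_pos k with rfl | hk
    · refine ⟨i, fun n => ?_⟩
      congr 1
      funext v
      have := hr v
      simp at this
    have hp : 0 < k ^ p := by positivity
    obtain ⟨j, hj⟩ := ih (fun v => r v % k ^ p) (fun v => Nat.mod_lt _ hp)
    obtain ⟨j', hj'⟩ := hF j (fun v => r v / k ^ p)
      (fun v => Nat.div_lt_of_lt_mul (by rw [← pow_succ]; exact hr v))
    refine ⟨j', fun n => ?_⟩
    rw [← hj', ← hj]
    congr 1
    funext v
    have := Nat.div_add_mod (r v) (k ^ p)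
    simp only [appendDigits]
    rw [Nat.mul_add, add_assoc, this, pow_succ, mul_assoc]

variable [DecidableEq V]

theorem appendDigits_update (n r : V → ℕ) (v : V) (q c : ℕ) :
    appendDigits k (Function.update n v q) (Function.update r v c) =
      Function.update (appendDigits k n r) v (k * q + c) := by
  funext w
  by_cases h : w = v
  · subst h; simp [appendDigits]
  · simp [appendDigits, h]

/-- Subset construction: the last digit of the quantified argument is guessed, and a set of kernel
elements records the outcomes of all guesses. -/
theorem IsAutomatic.exists_update {f : (V → ℕ) → Prop} (hf : IsAutomatic k N f) (v : V) :
    IsAutomatic k (2 ^ N) (fun n => ∃ a, f (Function.update n v a)) := by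
  classical
  obtain ⟨ι, _, F, hc, ⟨i, rfl⟩, hF⟩ := hf
  refine ⟨Set ι, inferInstance, fun T n => ∃ a, ∃ i ∈ T, F i (Function.update n v a), ?_,
    ⟨{i}, by simp⟩, fun T r hr => ?_⟩
  · rw [Fintype.card_set]; exact Nat.pow_le_pow_right (by norm_num) hc
  · have hk : 0 < k := by have := hr v; omega
    have hr' : ∀ c < k, ∀ w, Function.update r v c w < k := by
      intro c hc w
      by_cases h : w = v
      · subst h; simpa using hc
      · simpa [h] using hr w
    choose next hnext using hF
    refine ⟨{j | ∃ i ∈ T, ∃ c, ∃ hc : c < k, next i (Function.update r v c) (hr' c hc) = j},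
      fun n => ?_⟩
    apply propext
    constructor
    · rintro ⟨a, i, hi, h⟩
      refine ⟨a / k, _, ⟨i, hi, a % k, Nat.mod_lt _ hk, rfl⟩, ?_⟩
      rw [← hnext, appendDigits_update, Nat.div_add_mod]
      exact h
    · rintro ⟨q, _, ⟨i, hi, c, hc, rfl⟩, h⟩
      rw [← hnext, appendDigits_update] at h
      exact ⟨_, i, hi, h⟩

/-- Pumping: beyond the lowest e digits only the witness still has nonzero digits. If the least
witness had more than e + N digits, two of the kernel elements obtained by stripping e, …, e + N
digits would coincide, and cutting out the digits in between would give a smaller witness. -/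
theorem IsAutomatic.exists_update_lt {f : (V → ℕ) → Prop} (hf : IsAutomatic k N f) (hk : 2 ≤ k)
    {n : V → ℕ} {e : ℕ} (hn : ∀ v, n v < k ^ e) (v : V)
    (h : ∃ a, f (Function.update n v a)) : ∃ a < k ^ (e + N), f (Function.update n v a) := by
  classical
  obtain ⟨ι, _, F, hc, ⟨i, rfl⟩, hF⟩ := hf
  by_contra! hlt
  obtain ⟨a, ha, hmin⟩ : ∃ a, F i (Function.update n v a) ∧
      ∀ b < a, ¬ F i (Function.update n v b) :=
    ⟨Nat.find h, Nat.find_spec h, fun b hb => Nat.find_min h hb⟩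
  have hle : k ^ (e + N) ≤ a := by
    by_contra! hcon
    exact hlt a hcon ha
  have hj : ∀ p : Fin (N + 1), ∃ j, ∀ n', F i (appendDigits (k ^ (e + p)) n'
      (Function.update n v (a % k ^ (e + p)))) = F j n' := by
    intro p
    apply exists_kernel_pow hF
    intro w
    by_cases hw : w = v
    · subst hw; simpa using Nat.mod_lt _ (by positivity)
    · simpa [hw] using (hn w).trans_le (Nat.pow_le_pow_right (by omega) (by omega))
  choose j hj using hj
  -- The parameters lie entirely in the low digits, so their high parts are 0.
  have hshift : ∀ p Q c, appendDigits (k ^ p) (Function.update (fun _ => 0) v Q)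
      (Function.update n v c) = Function.update n v (k ^ p * Q + c) := by
    intro p Q c
    rw [appendDigits_update]
    congr 1
    funext w
    simp [appendDigits]
  obtain ⟨p, p', hpp, hjj⟩ : ∃ p p' : Fin (N + 1), p < p' ∧ j p = j p' := by
    obtain ⟨p, p', hne, h⟩ := Fintype.exists_ne_map_eq_of_card_lt j (by
      rw [Fintype.card_fin]; omega)
    rcases lt_or_gt_of_ne hne with h' | h'
    · exact ⟨p, p', h', h⟩
    · exact ⟨p', p, h', h.symm⟩
  have h1 := hj p (Function.update (fun _ => 0) v (a / k ^ (e + p')))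
  have h2 := hj p' (Function.update (fun _ => 0) v (a / k ^ (e + p')))
  rw [hshift] at h1 h2
  rw [Nat.div_add_mod] at h2
  rw [hjj, ← h2] at h1
  -- The shortened witness keeps the part above position e + p' and the digits below e + p. It is
  -- strictly smaller because that upper part is nonzero.
  refine hmin _ ?_ (h1.mpr ha)
  have hP : k ^ (e + p') ≤ a :=
    le_trans (Nat.pow_le_pow_right (by omega) (by have := p'.isLt; omega)) hle
  have hQ : 0 < a / k ^ (e + p') := Nat.div_pos hP (by positivity)
  have hm : a % k ^ (e + p) < k ^ (e + p) := Nat.mod_lt _ (by positivity)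
  have hp2 : k ^ (e + p) * 2 ≤ k ^ (e + p') := by
    calc k ^ (e + p) * 2 ≤ k ^ (e + p) * k := Nat.mul_le_mul_left _ hk
      _ = k ^ (e + p + 1) := (pow_succ _ _).symm
      _ ≤ _ := Nat.pow_le_pow_right (by omega) (by have : (p : ℕ) < p' := hpp; omega)
  have hdiv : k ^ (e + p') * (a / k ^ (e + p')) ≤ a := Nat.mul_div_le _ _
  nlinarith [Nat.mul_le_mul_right (a / k ^ (e + p')) hp2,
    Nat.mul_le_mul_left (k ^ (e + p)) hQ]

end Kernel

/-! ### Bounding the quantifiers -/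

section Bounds

variable {α : Type} [LinearOrder α]

/-- The suffix of `x` at `i` is smaller than the one at `j`, the first difference being at
distance `t`. -/
def LtAt (x : ℕ → α) (i j t : ℕ) : Prop :=
  (∀ s < t, x (i + s) = x (j + s)) ∧ x (i + t) < x (j + t)

/-- A kernel size for the relation `LtAt x`. -/
def ltAtBound (N : ℕ) : ℕ := 2 ^ (2 * (N * 2 * (N * 2))) * (N * 2 * (N * 2))

/-- A kernel size for the relation `i < j ∧ ¬ ∃ t, LtAt x i j t`. -/
def notLtBound (N : ℕ) : ℕ := 2 * 2 ^ ltAtBound N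

variable {k N : ℕ} {x : ℕ → α}

/-- Coordinates 0, 1, 2 hold i, j, t. Coordinate 3 is the bound variable s, whose universal
quantifier is written as ¬∃¬ to apply the subset construction. -/
theorem isAutomatic_ltAt (hx : IsAutomatic k N (fun n : Unit → ℕ => x (n ()))) :
    IsAutomatic k (ltAtBound N) (fun n : Fin 4 → ℕ => LtAt x (n 0) (n 1) (n 2)) := by
  have h1 : IsAutomatic k (2 * (N * 2 * (N * 2))) (fun n : Fin 4 → ℕ =>
      n 3 < n 2 ∧ ¬ x (n 0 + n 3) = x (n 1 + n 3)) :=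
    (isAutomatic_lt 3 2).map₂
      ((hx.comp_add 0 3).map₂ (hx.comp_add 1 3) fun a b => ¬ a = b) And
  have h2 := ((h1.exists_update 3).map Not).map₂
    ((hx.comp_add 0 2).map₂ (hx.comp_add 1 2) fun a b => a < b) And
  unfold ltAtBound
  convert h2 using 2 with n
  simp [LtAt]

theorem isAutomatic_not_lt (hx : IsAutomatic k N (fun n : Unit → ℕ => x (n ()))) :
    IsAutomatic k (notLtBound N)
      (fun n : Fin 4 → ℕ => n 0 < n 1 ∧ ¬ ∃ t, LtAt x (n 0) (n 1) t) := by
  have h := (isAutomatic_lt 0 1).map₂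
    (((isAutomatic_ltAt hx).exists_update 2).map Not) And
  unfold notLtBound
  convert h using 2 with n
  simp

theorem isAutomatic_forall_lt (hx : IsAutomatic k N (fun n : Unit → ℕ => x (n ()))) :
    IsAutomatic k (2 ^ notLtBound N)
      (fun n : Fin 4 → ℕ => ∀ j, n 0 < j → ∃ t, LtAt x (n 0) j t) := by
  have h := ((isAutomatic_not_lt hx).exists_update 1).map Not
  convert h using 2 with n
  simp

/-- The bounds on i and t come from least witnesses, the one on j from a least counterexample. Since
a < k ^ b whenever a ≤ b, the exponents i and i + j serve as crude digit counts for the parameters.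
-/
theorem exists_forall_exists_ltAt_iff (hk : 2 ≤ k)
    (hx : IsAutomatic k N (fun n : Unit → ℕ => x (n ()))) :
    (∃ i, ∀ j, i < j → ∃ t, LtAt x i j t) ↔
      ∃ i < k ^ 2 ^ notLtBound N, ∀ j < k ^ (i + notLtBound N), i < j →
        ∃ t < k ^ (i + j + ltAtBound N), LtAt x i j t := by
  have hpow : ∀ a b, a ≤ b → a < k ^ b := fun a b hab =>
    hab.trans_lt (Nat.lt_pow_self (by omega))
  constructor
  · rintro ⟨i, hi⟩
    obtain ⟨i, hlt, hi⟩ := (isAutomatic_forall_lt hx).exists_update_lt hk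
      (n := fun _ => 0) (e := 0) (by simp) 0 ⟨i, by simpa using hi⟩
    refine ⟨i, by simpa using hlt, fun j _ hij => ?_⟩
    obtain ⟨t, ht, h⟩ := (isAutomatic_ltAt hx).exists_update_lt hk
      (n := ![i, j, 0, 0]) (e := i + j) (by
        intro v
        fin_cases v <;> apply hpow <;> simp) 2
      (by simpa using hi j (by simpa using hij))
    exact ⟨t, ht, by simpa using h⟩
  · rintro ⟨i, -, hi⟩
    refine ⟨i, ?_⟩
    by_contra hcon
    obtain ⟨j, hj, h⟩ := (isAutomatic_not_lt hx).exists_update_lt hk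
      (n := ![i, 0, 0, 0]) (e := i) (by
        intro v
        fin_cases v <;> apply hpow <;> simp) 1
      (by
        push Not at hcon
        simpa using hcon)
    simp only [Function.update_self] at h
    obtain ⟨t, -, ht⟩ := hi j hj (by simpa using h.1)
    exact h.2 ⟨t, by simpa using ht⟩

end Bounds

/-! ### Sequences generated by automata -/

section Generated

variable {k m s : ℕ}

theorem isBaseRep_exists (hk : 2 ≤ k) (n : ℕ) : ∃ w : List (Fin k), IsBaseRep w n := by
  refine ⟨(Nat.digits k n).reverse.pmap (fun a h => ⟨a, h⟩) (fun a ha => ?_), ?_⟩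
  · exact Nat.digits_lt_base (by omega) (List.mem_reverse.mp ha)
  · simp [IsBaseRep, List.map_pmap]

theorem isBaseRep_append (hk : 2 ≤ k) {n : ℕ} (hn : n ≠ 0) {w : List (Fin k)}
    (hw : IsBaseRep w (n / k)) :
    IsBaseRep (w ++ [⟨n % k, Nat.mod_lt _ (by omega)⟩]) n := by
  have : Nat.digits k n = n % k :: Nat.digits k (n / k) :=
    Nat.digits_def' (by omega) (by omega)
  unfold IsBaseRep at *
  simp [hw, this]

theorem IsBaseRep.unique {n : ℕ} {w w' : List (Fin k)} (hw : IsBaseRep w n)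
    (hw' : IsBaseRep w' n) : w = w' :=
  List.map_injective_iff.mpr Fin.val_injective (hw.trans hw'.symm)

/-- The state reached on reading the base-`k` representation of `n`. -/
noncomputable def DFAO.state (M : DFAO k m s) (hk : 2 ≤ k) (n : ℕ) : Fin m :=
  M.eval (isBaseRep_exists hk n).choose

theorem DFAO.state_zero (M : DFAO k m s) (hk : 2 ≤ k) : M.state hk 0 = M.start := by
  have h : IsBaseRep ([] : List (Fin k)) 0 := by simp [IsBaseRep]
  rw [DFAO.state, (isBaseRep_exists hk 0).choose_spec.unique h]
  rfl

theorem DFAO.state_of_ne_zero (M : DFAO k m s) (hk : 2 ≤ k) {n : ℕ} (hn : n ≠ 0) :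
    M.state hk n = M.step (M.state hk (n / k)) ⟨n % k, Nat.mod_lt _ (by omega)⟩ := by
  have h := isBaseRep_append hk hn (isBaseRep_exists hk (n / k)).choose_spec
  rw [DFAO.state, (isBaseRep_exists hk n).choose_spec.unique h]
  simp [DFAO.eval, DFAO.state]

theorem DFAO.Generates.eq_output {M : DFAO k m s} {x : ℕ → Fin s} (h : M.Generates x)
    (hk : 2 ≤ k) (n : ℕ) : x n = M.output (M.state hk n) :=
  (h n _ (isBaseRep_exists hk n).choose_spec).symm

/-- Appended low digits act on the state reached by n through a map `Fin m → Fin m`. For n = 0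
leading zeros must not be read, so a second component stores the state to use in that case; hence
the size m ^ m * m. -/
theorem DFAO.Generates.isAutomatic {M : DFAO k m s} {x : ℕ → Fin s} (h : M.Generates x)
    (hk : 2 ≤ k) : IsAutomatic k (m ^ m * m) (fun n : Unit → ℕ => x (n ())) := by
  refine ⟨(Fin m → Fin m) × Fin m, inferInstance,
    fun p n => M.output (if n () = 0 then p.2 else p.1 (M.state hk (n ()))), by simp,
    ⟨(id, M.start), ?_⟩, fun p r hr => ?_⟩
  · funext n
    rw [h.eq_output hk]
    by_cases h0 : n () = 0 <;> simp [h0, M.state_zero hk]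
  · have hr := hr ()
    refine ⟨(fun q => p.1 (M.step q ⟨r (), hr⟩),
      if r () = 0 then p.2 else p.1 (M.state hk (r ()))), fun n => ?_⟩
    have happ : appendDigits k n r () = k * n () + r () := rfl
    beta_reduce
    rw [happ]
    by_cases hn : n () = 0
    · simp [hn]
    · have hne : k * n () + r () ≠ 0 := by
        have : 0 < k * n () := Nat.mul_pos (by omega) (by omega)
        omega
      rw [if_neg hne, if_neg hn, M.state_of_ne_zero hk hne]
      have hd : (k * n () + r ()) / k = n () := by
        rw [Nat.mul_add_div (by omega), Nat.div_eq_of_lt hr, add_zero]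
      have hm : (k * n () + r ()) % k = r () := by
        rw [Nat.mul_add_mod, Nat.mod_eq_of_lt hr]
      simp only [hd, hm]

end Generated

/-! ### The decision procedure -/

section Decision

/-- The state reached by the described automaton on reading the digits of `n` at positions
`n - 1, …, n - e`, ignoring leading zeros. -/
def Description.stateAux (d : Description) (n e : ℕ) : ℕ :=
  Nat.rec d.2.1 (fun e q => if n / d.1 ^ (n - (e + 1)) = 0 then d.2.1 else
    (d.2.2.1.getD q []).getD (n / d.1 ^ (n - (e + 1)) % d.1) 0) e

/-- The `n`-th letter of the sequence generated by the described automaton. -/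
def Description.letter (d : Description) (n : ℕ) : ℕ :=
  d.2.2.2.getD (d.stateAux n n) 0

/-- A kernel size for the sequence generated by the described automaton. -/
def Description.kernelBound (d : Description) : ℕ :=
  d.2.2.1.length ^ d.2.2.1.length * d.2.2.1.length

/-- Some suffix of the sequence generated by the described automaton is smaller than its own
suffixes, all quantifiers being bounded. -/
def Description.HasLyndonSuffix (d : Description) : Prop :=
  ∃ i < d.1 ^ 2 ^ notLtBound d.kernelBound, ∀ j < d.1 ^ (i + notLtBound d.kernelBound), i < j →
    ∃ t < d.1 ^ (i + j + ltAtBound d.kernelBound), LtAt d.letter i j t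

theorem primrec₂_pow : Primrec₂ (fun a b : ℕ => a ^ b) := by
  refine (Primrec.nat_rec (f := fun _ : ℕ => 1) (g := fun a p => p.2 * a) (Primrec.const 1)
    (Primrec.nat_mul.comp (Primrec.snd.comp Primrec.snd) Primrec.fst)).of_eq fun a b => ?_
  induction b with
  | zero => rfl
  | succ b ih => rw [pow_succ, ← ih]

theorem primrec_pow {α : Type} [Primcodable α] {f g : α → ℕ} (hf : Primrec f) (hg : Primrec g) :
    Primrec fun a => f a ^ g a :=
  primrec₂_pow.comp hf hg

theorem primrec_stateAux :
    Primrec fun p : (Description × ℕ) × ℕ => p.1.1.stateAux p.1.2 p.2 := by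
  open Primrec in
  have hd : Primrec fun a : (Description × ℕ) × ℕ × ℕ => a.1.1 := fst.comp fst
  have hk : Primrec fun a : (Description × ℕ) × ℕ × ℕ => a.1.1.1 := fst.comp hd
  have hs : Primrec fun a : (Description × ℕ) × ℕ × ℕ => a.1.1.2.1 := fst.comp (snd.comp hd)
  have ht : Primrec fun a : (Description × ℕ) × ℕ × ℕ => a.1.1.2.2.1 :=
    fst.comp (snd.comp (snd.comp hd))
  have hn : Primrec fun a : (Description × ℕ) × ℕ × ℕ => a.1.2 := snd.comp fst
  have he : Primrec fun a : (Description × ℕ) × ℕ × ℕ => a.2.1 := fst.comp snd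
  have hr : Primrec fun a : (Description × ℕ) × ℕ × ℕ => a.2.2 := snd.comp snd
  have hp : Primrec fun a : (Description × ℕ) × ℕ × ℕ => a.1.1.1 ^ (a.1.2 - (a.2.1 + 1)) :=
    primrec_pow hk (nat_sub.comp hn (succ.comp he))
  have hq : Primrec fun a : (Description × ℕ) × ℕ × ℕ =>
      a.1.2 / a.1.1.1 ^ (a.1.2 - (a.2.1 + 1)) := nat_div.comp hn hp
  have hz : PrimrecPred fun a : (Description × ℕ) × ℕ × ℕ =>
      a.1.2 / a.1.1.1 ^ (a.1.2 - (a.2.1 + 1)) = 0 := Primrec.eq.comp hq (const 0)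
  have hm : Primrec fun a : (Description × ℕ) × ℕ × ℕ =>
      a.1.2 / a.1.1.1 ^ (a.1.2 - (a.2.1 + 1)) % a.1.1.1 := nat_mod.comp hq hk
  have hrow : Primrec fun a : (Description × ℕ) × ℕ × ℕ => a.1.1.2.2.1.getD a.2.2 [] :=
    (list_getD []).comp ht hr
  have hcell : Primrec fun a : (Description × ℕ) × ℕ × ℕ => (a.1.1.2.2.1.getD a.2.2 []).getD
      (a.1.2 / a.1.1.1 ^ (a.1.2 - (a.2.1 + 1)) % a.1.1.1) 0 := (list_getD 0).comp hrow hm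
  have hs0 : Primrec fun a : Description × ℕ => a.1.2.1 := fst.comp (snd.comp fst)
  have hg : Primrec₂ fun (a : Description × ℕ) (p : ℕ × ℕ) =>
      if a.2 / a.1.1 ^ (a.2 - (p.1 + 1)) = 0 then a.1.2.1 else
        (a.1.2.2.1.getD p.2 []).getD (a.2 / a.1.1 ^ (a.2 - (p.1 + 1)) % a.1.1) 0 :=
    ite hz hs hcell
  have h := nat_rec hs0 hg
  exact h

theorem primrec_letter : Primrec₂ Description.letter :=
  open Primrec in
  (list_getD 0).comp (snd.comp (snd.comp (snd.comp fst)))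
    (primrec_stateAux.comp (pair Primrec.id snd))

theorem primrec_kernelBound : Primrec Description.kernelBound :=
  open Primrec in
  have h : Primrec fun d : Description => d.2.2.1.length :=
    list_length.comp (fst.comp (snd.comp snd))
  nat_mul.comp (primrec_pow h h) h

theorem primrec_ltAtBound : Primrec ltAtBound :=
  open Primrec in
  have h : Primrec fun N : ℕ => N * 2 * (N * 2) :=
    nat_mul.comp (nat_mul.comp Primrec.id (const 2)) (nat_mul.comp Primrec.id (const 2))
  nat_mul.comp (primrec_pow (const 2) (nat_mul.comp (const 2) h)) h

theorem primrec_notLtBound : Primrec notLtBound :=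
  open Primrec in
  nat_mul.comp (const 2) (primrec_pow (const 2) primrec_ltAtBound)

theorem primrecPred_exists_lt {α : Type} [Primcodable α] {R : ℕ → α → Prop} {b : α → ℕ}
    (hR : PrimrecRel R) (hb : Primrec b) : PrimrecPred fun a => ∃ x < b a, R x a :=
  (hR.exists_mem_list.comp (Primrec.list_range.comp hb) Primrec.id).of_eq fun a => by simp

theorem primrecPred_forall_lt {α : Type} [Primcodable α] {R : ℕ → α → Prop} {b : α → ℕ}
    (hR : PrimrecRel R) (hb : Primrec b) : PrimrecPred fun a => ∀ x < b a, R x a :=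
  (hR.forall_mem_list.comp (Primrec.list_range.comp hb) Primrec.id).of_eq fun a => by simp

theorem primrecPred_ltAt {α : Type} [Primcodable α] {d : α → Description} {i j t : α → ℕ}
    (hd : Primrec d) (hi : Primrec i) (hj : Primrec j) (ht : Primrec t) :
    PrimrecPred fun a => LtAt (d a).letter (i a) (j a) (t a) := by
  open Primrec in
  have h1 : PrimrecRel fun (s : ℕ) (a : α) =>
      (d a).letter (i a + s) = (d a).letter (j a + s) :=
    Primrec.eq.comp
      (primrec_letter.comp (hd.comp snd) (nat_add.comp (hi.comp snd) fst))
      (primrec_letter.comp (hd.comp snd) (nat_add.comp (hj.comp snd) fst))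
  have h2 : PrimrecPred fun a => ∀ s < t a, (d a).letter (i a + s) = (d a).letter (j a + s) :=
    primrecPred_forall_lt h1 ht
  have h3 : PrimrecPred fun a => (d a).letter (i a + t a) < (d a).letter (j a + t a) :=
    nat_lt.comp (primrec_letter.comp hd (nat_add.comp hi ht))
      (primrec_letter.comp hd (nat_add.comp hj ht))
  exact h2.and h3

theorem primrecPred_hasLyndonSuffix : PrimrecPred Description.HasLyndonSuffix := by
  open Primrec in
  have h2 : PrimrecPred fun a : ℕ × ℕ × Description => a.2.1 < a.1 →
      ∃ t < a.2.2.1 ^ (a.2.1 + a.1 + ltAtBound a.2.2.kernelBound), LtAt a.2.2.letter a.2.1 a.1 t := by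
    have hj : Primrec fun a : ℕ × ℕ × Description => a.1 := fst
    have hi : Primrec fun a : ℕ × ℕ × Description => a.2.1 := fst.comp snd
    have hd : Primrec fun a : ℕ × ℕ × Description => a.2.2 := snd.comp snd
    have hk : Primrec fun a : ℕ × ℕ × Description => a.2.2.1 := fst.comp hd
    have hN : Primrec fun a : ℕ × ℕ × Description => ltAtBound a.2.2.kernelBound :=
      primrec_ltAtBound.comp (primrec_kernelBound.comp hd)
    have hp : Primrec fun a : ℕ × ℕ × Description =>
        a.2.2.1 ^ (a.2.1 + a.1 + ltAtBound a.2.2.kernelBound) :=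
      primrec_pow hk (nat_add.comp (nat_add.comp hi hj) hN)
    have h1' : PrimrecRel fun (t : ℕ) (a : ℕ × ℕ × Description) =>
        LtAt a.2.2.letter a.2.1 a.1 t :=
      primrecPred_ltAt (hd.comp snd) (hi.comp snd) (hj.comp snd) fst
    have h : PrimrecPred fun a : ℕ × ℕ × Description =>
        ∃ t < a.2.2.1 ^ (a.2.1 + a.1 + ltAtBound a.2.2.kernelBound),
          LtAt a.2.2.letter a.2.1 a.1 t := primrecPred_exists_lt h1' hp
    have hlt : PrimrecPred fun a : ℕ × ℕ × Description => ¬ a.2.1 < a.1 :=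
      (nat_lt.comp hi hj).not
    exact (hlt.or h).of_eq fun a => imp_iff_not_or.symm
  have hp2 : Primrec fun a : ℕ × Description => a.2.1 ^ (a.1 + notLtBound a.2.kernelBound) :=
    primrec_pow (fst.comp snd) (nat_add.comp fst
      (primrec_notLtBound.comp (primrec_kernelBound.comp snd)))
  have h2' : PrimrecRel fun (j : ℕ) (p : ℕ × Description) => p.1 < j →
      ∃ t < p.2.1 ^ (p.1 + j + ltAtBound p.2.kernelBound), LtAt p.2.letter p.1 j t := h2
  have h3 : PrimrecRel fun (i : ℕ) (d : Description) =>
      ∀ j < d.1 ^ (i + notLtBound d.kernelBound), i < j →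
        ∃ t < d.1 ^ (i + j + ltAtBound d.kernelBound), LtAt d.letter i j t :=
    primrecPred_forall_lt h2' hp2
  have hp3 : Primrec fun d : Description => d.1 ^ 2 ^ notLtBound d.kernelBound :=
    primrec_pow fst (primrec_pow (const 2) (primrec_notLtBound.comp primrec_kernelBound))
  exact primrecPred_exists_lt h3 hp3

variable {k m s : ℕ}

theorem DFAO.stateAux_description (M : DFAO k m s) (hk : 2 ≤ k) (n e : ℕ) (he : e ≤ n) :
    M.description.stateAux n e = M.state hk (n / k ^ (n - e)) := by
  induction e with
  | zero =>
    -- Since n < k ^ n, scanning n digit positions suffices, and the prefix before the first of them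
    -- is 0.
    rw [Nat.sub_zero, Nat.div_eq_of_lt (Nat.lt_pow_self (by omega)), M.state_zero]
    rfl
  | succ e ih =>
    have ih := ih (by omega)
    have hstep : M.description.stateAux n (e + 1) =
        if n / k ^ (n - (e + 1)) = 0 then (M.start : ℕ) else
          (M.description.2.2.1.getD (M.description.stateAux n e) []).getD
            (n / k ^ (n - (e + 1)) % k) 0 := rfl
    have hdiv : n / k ^ (n - e) = n / k ^ (n - (e + 1)) / k := by
      rw [Nat.div_div_eq_div_mul, ← pow_succ]
      congr 2
      omega
    rw [hstep, ih, hdiv]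
    split_ifs with h0
    · rw [h0, M.state_zero]
    · rw [M.state_of_ne_zero hk h0]
      have hlt : n / k ^ (n - (e + 1)) % k < k := Nat.mod_lt _ (by omega)
      -- State and digit are within the tables, so the default values of `getD` are never used.
      simp [DFAO.description, List.getD_eq_getElem?_getD, hlt]

theorem DFAO.Generates.letter_description {M : DFAO k m s} {x : ℕ → Fin s} (h : M.Generates x)
    (hk : 2 ≤ k) (n : ℕ) : M.description.letter n = x n := by
  rw [h.eq_output hk, Description.letter, M.stateAux_description hk n n le_rfl]
  simp [DFAO.description, List.getD_eq_getElem?_getD]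

theorem DFAO.Generates.hasLyndonSuffix_iff {M : DFAO k m s} {x : ℕ → Fin s} (h : M.Generates x)
    (hk : 2 ≤ k) :
    M.description.HasLyndonSuffix ↔ ∃ i, ∀ j, i < j → ∃ t, LtAt x i j t := by
  have hb : M.description.kernelBound = m ^ m * m := by
    simp [Description.kernelBound, DFAO.description]
  have hl : ∀ i j t, LtAt M.description.letter i j t ↔ LtAt x i j t := fun i j t => by
    simp [LtAt, h.letter_description hk, Fin.ext_iff]
  rw [exists_forall_exists_ltAt_iff hk (h.isAutomatic hk)]
  unfold Description.HasLyndonSuffix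
  simp only [hb, hl]
  rfl

end Decision

/-! ### Finite Lyndon words -/

section LyndonWords

variable {Γ : Type} [LinearOrder Γ]

/-- `u` is smaller than `v` because of a smaller letter at the first difference. -/
def StrictLt (u v : List Γ) : Prop :=
  ∃ (t : ℕ) (hu : t < u.length) (hv : t < v.length),
    (∀ (i : ℕ) (hi : i < t), u[i] = v[i]) ∧ u[t] < v[t]

theorem lt_iff_prefix_or_strictLt {u v : List Γ} :
    u < v ↔ (∃ s, s ≠ [] ∧ v = u ++ s) ∨ StrictLt u v := by
  rw [List.lt_iff_exists]
  refine or_congr ⟨fun ⟨h, hl⟩ => ⟨v.drop u.length, ?_, ?_⟩, ?_⟩ Iff.rfl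
  · simpa using hl
  · conv_lhs => rw [← List.take_append_drop u.length v, ← h]
  · rintro ⟨s, hs, rfl⟩
    simpa using List.length_pos_iff.mpr hs

theorem StrictLt.lt {u v : List Γ} (h : StrictLt u v) : u < v :=
  lt_iff_prefix_or_strictLt.mpr (Or.inr h)

theorem StrictLt.append {u v : List Γ} (h : StrictLt u v) (a b : List Γ) :
    StrictLt (u ++ a) (v ++ b) := by
  obtain ⟨t, hu, hv, h, hlt⟩ := h
  refine ⟨t, by simp; omega, by simp; omega, fun i hi => ?_, ?_⟩
  · rw [List.getElem_append_left (by omega), List.getElem_append_left (by omega)]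
    exact h i hi
  · rwa [List.getElem_append_left, List.getElem_append_left]

theorem strictLt_of_lt_of_length_le {u v : List Γ} (h : u < v) (hl : v.length ≤ u.length) :
    StrictLt u v := by
  rcases lt_iff_prefix_or_strictLt.mp h with ⟨s, hs, rfl⟩ | h
  · have := List.length_pos_iff.mpr hs
    simp at hl
    exact absurd hl hs
  · exact h

theorem append_lt_append_left_iff {p u v : List Γ} : p ++ u < p ++ v ↔ u < v := by
  induction p with
  | nil => rfl
  | cons a p ih => simpa [List.cons_lt_cons_iff] using ih

theorem le_append_right (u v : List Γ) : u ≤ u ++ v := by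
  rcases eq_or_ne v [] with rfl | h
  · simp
  · exact (lt_iff_prefix_or_strictLt.mpr (Or.inl ⟨v, h, rfl⟩)).le

omit [LinearOrder Γ] in
-- Euclid's algorithm on lengths: of two commuting words the shorter is a prefix of the longer, and
-- the remainder still commutes with it.
theorem exists_flatten_replicate_of_append_comm (n : ℕ) (u v : List Γ)
    (hn : u.length + v.length ≤ n) (h : u ++ v = v ++ u) :
    ∃ (z : List Γ) (a b : ℕ),
      u = (List.replicate a z).flatten ∧ v = (List.replicate b z).flatten := by
  induction n generalizing u v with
  | zero =>
    have hu : u = [] := List.length_eq_zero_iff.mp (by omega)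
    have hv : v = [] := List.length_eq_zero_iff.mp (by omega)
    exact ⟨[], 0, 0, by simp [hu], by simp [hv]⟩
  | succ n ih =>
    rcases eq_or_ne u [] with rfl | hu
    · exact ⟨v, 0, 1, by simp, by simp⟩
    rcases eq_or_ne v [] with rfl | hv
    · exact ⟨u, 1, 0, by simp, by simp⟩
    have hu' := List.length_pos_iff.mpr hu
    have hv' := List.length_pos_iff.mpr hv
    rcases List.append_eq_append_iff.mp h with ⟨c, h1, h2⟩ | ⟨c, h1, h2⟩
    · have hl : v.length = u.length + c.length := by rw [h1]; simp
      obtain ⟨z, a, b, ha, hb⟩ := ih u c (by omega) (h1.symm.trans h2)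
      exact ⟨z, a, a + b, ha, by rw [h1, List.replicate_add, List.flatten_append, ← ha, ← hb]⟩
    · have hl : u.length = v.length + c.length := by rw [h1]; simp
      obtain ⟨z, a, b, ha, hb⟩ := ih c v (by omega) (h2.symm.trans h1)
      exact ⟨z, b + a, b, by rw [h1, List.replicate_add, List.flatten_append, ← ha, ← hb], hb⟩

omit [LinearOrder Γ] in
theorem isPower_of_append_comm {u v : List Γ} (hu : u ≠ []) (hv : v ≠ [])
    (h : u ++ v = v ++ u) : IsPower (u ++ v) := by
  obtain ⟨z, a, b, rfl, rfl⟩ := exists_flatten_replicate_of_append_comm _ u v le_rfl h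
  have ha : a ≠ 0 := by rintro rfl; simp at hu
  have hb : b ≠ 0 := by rintro rfl; simp at hv
  exact ⟨z, a + b, by omega, by rw [List.replicate_add, List.flatten_append]⟩

/-- If v is smaller than uv by a letter, the conjugate vu beats uv. If v is a prefix, uv = vu', then
minimality against vu and u'v forces u' = u, so u and v commute and uv is a power. -/
theorem IsLyndon.strictLt_suffix {u v : List Γ} (h : IsLyndon (u ++ v)) (hu : u ≠ [])
    (hv : v ≠ []) : StrictLt (u ++ v) v := by
  have hu' := List.length_pos_iff.mpr hu
  have hconj := h.2 u v rfl
  rcases lt_trichotomy (u ++ v) v with hlt | heq | hgt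
  · exact strictLt_of_lt_of_length_le hlt (by simp)
  · exact absurd (by simpa using heq) hu
  rcases lt_iff_prefix_or_strictLt.mp hgt with ⟨u', -, huv⟩ | hgt
  · exfalso
    have hlen : u'.length = u.length := by
      have := congrArg List.length huv
      simp at this
      omega
    have h1 : u' ≤ u := by
      rw [huv] at hconj
      by_contra! hcon
      exact hconj.not_gt (append_lt_append_left_iff.mpr hcon)
    have h2 : u ≤ u' := by
      by_contra! hcon
      exact (h.2 v u' huv).not_gt
        ((strictLt_of_lt_of_length_le hcon hlen.ge).append v v).lt
    obtain rfl := le_antisymm h1 h2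
    exact h.1.2 (isPower_of_append_comm hu hv huv)
  · have := (hgt.append u []).lt
    rw [List.append_nil] at this
    exact absurd this hconj.not_gt

theorem isLyndon_of_strictLt_suffix {w : List Γ} (hw : w ≠ [])
    (h : ∀ u v, w = u ++ v → u ≠ [] → v ≠ [] → StrictLt w v) : IsLyndon w := by
  refine ⟨⟨hw, ?_⟩, fun u v huv => ?_⟩
  · rintro ⟨z, e, he, hz⟩
    obtain ⟨e, rfl⟩ : ∃ e', e = e' + 2 := ⟨e - 2, by omega⟩
    have hne : z ≠ [] := by
      rintro rfl
      simp at hz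
      exact hw hz
    have h1 : w = (List.replicate (e + 1) z).flatten ++ z := by
      rw [hz, List.replicate_succ', List.flatten_append]
      simp
    have h2 : w = z ++ (List.replicate (e + 1) z).flatten := by
      rw [hz, List.replicate_succ, List.flatten_cons]
    -- In a power, z is both a proper suffix and a prefix.
    have h3 : StrictLt w z := h _ z h1 (by simp [List.replicate_succ, hne]) hne
    have h4 : z ≤ w := h2 ▸ le_append_right _ _
    exact h4.not_gt h3.lt
  · rcases eq_or_ne u [] with rfl | hu
    · simp [huv]
    rcases eq_or_ne v [] with rfl | hv
    · simp [huv]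
    have := ((h u v huv hu hv).append [] u).lt
    rw [List.append_nil] at this
    exact this.le

end LyndonWords

/-! ### Factors of infinite words -/

section Factors

variable {Γ : Type}

/-- The factor of length `n` of `x` at `p`. -/
def factor (x : ℕ → Γ) (p n : ℕ) : List Γ :=
  List.ofFn fun i : Fin n => x (p + i)

@[simp]
theorem length_factor (x : ℕ → Γ) (p n : ℕ) : (factor x p n).length = n := by
  simp [factor]

@[simp]
theorem getElem_factor (x : ℕ → Γ) (p n i : ℕ) (h : i < (factor x p n).length) :
    (factor x p n)[i] = x (p + i) := by
  simp [factor]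

theorem factor_add (x : ℕ → Γ) (p n m : ℕ) :
    factor x p (n + m) = factor x p n ++ factor x (p + n) m := by
  apply List.ext_getElem
  · simp
  · intro i h1 h2
    rw [List.getElem_append]
    split_ifs with h
    · simp
    · simp only [length_factor] at h
      simp only [getElem_factor, length_factor]
      congr 1
      omega

theorem isPrefixOf_factor [LinearOrder Γ] (x : ℕ → Γ) (n : ℕ) : IsPrefixOf (factor x 0 n) x := by
  intro i hi
  simp

theorem eq_factor_of_append_eq_factor {x : ℕ → Γ} {p n : ℕ} {u v : List Γ}
    (h : u ++ v = factor x p n) :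
    u = factor x p u.length ∧ v = factor x (p + u.length) v.length := by
  have hn : n = u.length + v.length := by
    have := congrArg List.length h
    simpa using this.symm
  rw [hn, factor_add] at h
  exact List.append_inj h (by simp)

variable [LinearOrder Γ] {x : ℕ → Γ}

theorem LtAt.trans {i j l t t' : ℕ} (h : LtAt x i j t) (h' : LtAt x j l t') :
    LtAt x i l (min t t') := by
  refine ⟨fun s hs => (h.1 s (by omega)).trans (h'.1 s (by omega)), ?_⟩
  rcases lt_trichotomy t t' with hlt | rfl | hlt
  · rw [min_eq_left hlt.le, ← h'.1 t hlt]
    exact h.2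
  · rw [min_self]
    exact h.2.trans h'.2
  · rw [min_eq_right hlt.le, h.1 t' hlt]
    exact h'.2

theorem LtAt.asymm {i j t t' : ℕ} (h : LtAt x i j t) (h' : LtAt x j i t') : False :=
  lt_irrefl _ (h.trans h').2

theorem LtAt.of_prefix {i j n t : ℕ} (h : ∀ s < n, x (i + s) = x (j + s))
    (h' : LtAt x (i + n) (j + n) t) : LtAt x i j (n + t) := by
  refine ⟨fun s hs => ?_, ?_⟩
  · rcases lt_or_ge s n with hsn | hsn
    · exact h s hsn
    · have := h'.1 (s - n) (by omega)
      rwa [show i + n + (s - n) = i + s by omega, show j + n + (s - n) = j + s by omega] at this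
  · rw [← add_assoc, ← add_assoc]
    exact h'.2

theorem ltAt_trichotomy (x : ℕ → Γ) (i j n : ℕ) :
    (∃ t < n, LtAt x i j t) ∨ (∃ t < n, LtAt x j i t) ∨ ∀ s < n, x (i + s) = x (j + s) := by
  induction n with
  | zero => simp
  | succ n ih =>
    rcases ih with ⟨t, ht, h⟩ | ⟨t, ht, h⟩ | h
    · exact Or.inl ⟨t, by omega, h⟩
    · exact Or.inr (Or.inl ⟨t, by omega, h⟩)
    rcases lt_trichotomy (x (i + n)) (x (j + n)) with hlt | heq | hgt
    · exact Or.inl ⟨n, by omega, h, hlt⟩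
    · refine Or.inr (Or.inr fun s hs => ?_)
      rcases Nat.lt_succ_iff_lt_or_eq.mp hs with hs | rfl
      · exact h s hs
      · exact heq
    · exact Or.inr (Or.inl ⟨n, by omega, fun s hs => (h s hs).symm, hgt⟩)

theorem strictLt_factor_iff {p q n m : ℕ} :
    StrictLt (factor x p n) (factor x q m) ↔ ∃ t, t < n ∧ t < m ∧ LtAt x p q t := by
  simp only [StrictLt, length_factor, getElem_factor, LtAt]
  constructor
  · rintro ⟨t, h1, h2, h⟩
    exact ⟨t, h1, h2, h⟩
  · rintro ⟨t, h1, h2, h⟩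
    exact ⟨t, h1, h2, h⟩

theorem lt_factor_iff {p q n m : ℕ} :
    factor x p n < factor x q m ↔
      (n < m ∧ ∀ s < n, x (p + s) = x (q + s)) ∨ ∃ t, t < n ∧ t < m ∧ LtAt x p q t := by
  rw [lt_iff_prefix_or_strictLt, strictLt_factor_iff]
  refine or_congr_left ⟨?_, ?_⟩
  · rintro ⟨s, hs, h⟩
    have hs' := List.length_pos_iff.mpr hs
    have hm : m = n + s.length := by
      have := congrArg List.length h
      simpa using this
    refine ⟨by omega, fun i hi => ?_⟩
    have h1 : (factor x q m)[i]'(by simp; omega) = (factor x p n ++ s)[i]'(by simp; omega) := by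
      simp only [h]
    rw [List.getElem_append_left (by simpa using hi)] at h1
    simpa using h1.symm
  · rintro ⟨hlt, h⟩
    obtain ⟨l, rfl⟩ := Nat.exists_eq_add_of_lt hlt
    refine ⟨factor x (q + n) (l + 1), ?_, ?_⟩
    · rw [← List.length_pos_iff]
      simp
    · rw [add_assoc, factor_add]
      congr 1
      apply List.ext_getElem (by simp)
      intro i h1 h2
      simpa using (h i (by simpa using h2)).symm

/-- The factor of length `n` of `x` at `p` is a Lyndon word. -/
def LyndonAt (x : ℕ → Γ) (p n : ℕ) : Prop :=
  0 < n ∧ ∀ r, 0 < r → r < n → ∃ t, r + t < n ∧ LtAt x p (p + r) t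

theorem isLyndon_factor_iff {p n : ℕ} : IsLyndon (factor x p n) ↔ LyndonAt x p n := by
  constructor
  · intro h
    have hn : 0 < n := by
      have := List.length_pos_iff.mpr h.1.1
      simpa using this
    refine ⟨hn, fun r hr hrn => ?_⟩
    obtain ⟨l, rfl⟩ := Nat.exists_eq_add_of_lt hrn
    rw [add_assoc, factor_add] at h
    have h1 := h.strictLt_suffix (by rw [← List.length_pos_iff]; simpa using hr)
      (by rw [← List.length_pos_iff]; simp)
    rw [← factor_add, strictLt_factor_iff] at h1
    obtain ⟨t, -, ht, h1⟩ := h1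
    exact ⟨t, by omega, h1⟩
  · rintro ⟨hn, h⟩
    refine isLyndon_of_strictLt_suffix (by rw [← List.length_pos_iff]; simpa using hn) ?_
    intro u v huv hu hv
    have hu' := List.length_pos_iff.mpr hu
    have hv' := List.length_pos_iff.mpr hv
    have hlen : n = u.length + v.length := by
      have := congrArg List.length huv
      simpa using this
    obtain ⟨t, ht, hlt⟩ := h u.length hu' (by omega)
    rw [(eq_factor_of_append_eq_factor huv.symm).2, strictLt_factor_iff]
    exact ⟨t, by omega, by omega, hlt⟩

/-- The suffix of `x` at `p` is an infinite Lyndon word. -/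
def InfLyndonAt (x : ℕ → Γ) (p : ℕ) : Prop :=
  ∀ j, p < j → ∃ t, LtAt x p j t

theorem isInfLyndon_infSuffix_iff {p : ℕ} : IsInfLyndon (infSuffix x p) ↔ InfLyndonAt x p := by
  have key : ∀ j, InfLt (infSuffix x p) (infSuffix (infSuffix x p) j) ↔
      ∃ t, LtAt x p (p + j) t := by
    intro j
    simp only [InfLt, infSuffix, LtAt, add_assoc]
  constructor
  · intro h j hj
    have := (key (j - p)).mp (h (j - p) (by omega))
    rwa [show p + (j - p) = j by omega] at this
  · intro h j hj
    exact (key j).mpr (h _ (by omega))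

/-- Arbitrarily long Lyndon prefixes would make the suffix infinite Lyndon, since the comparison
with any j is decided inside a long enough one. A single letter is always Lyndon. -/
theorem exists_max_lyndonAt {p : ℕ} (h : ¬ InfLyndonAt x p) :
    ∃ n, LyndonAt x p n ∧ ∀ n', n < n' → ¬ LyndonAt x p n' := by
  by_contra! hcon
  have hub : ∀ N, ∃ n, N < n ∧ LyndonAt x p n := by
    intro N
    induction N with
    | zero => exact ⟨1, by omega, by omega, fun r h0 h1 => by omega⟩
    | succ N ih =>
      obtain ⟨n, hn, hL⟩ := ih
      obtain ⟨n', hn', hL'⟩ := hcon n hL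
      exact ⟨n', by omega, hL'⟩
  refine h fun j hj => ?_
  obtain ⟨n, hn, hL⟩ := hub (j - p)
  obtain ⟨t, -, ht⟩ := hL.2 (j - p) (by omega) hn
  rw [show p + (j - p) = j by omega] at ht
  exact ⟨t, ht⟩

/-- The classical fact that Lyndon words u < v have Lyndon product uv. With maximality of the greedy
factors it yields the non-increasing order. -/
theorem LyndonAt.append {p n m : ℕ} (h : LyndonAt x p n) (h' : LyndonAt x (p + n) m)
    (hlt : factor x p n < factor x (p + n) m) : LyndonAt x p (n + m) := by
  -- If u is a proper prefix of v, the difference is found by comparing v with its own suffix after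
  -- u.
  have key : ∃ t < m, LtAt x p (p + n) t := by
    rcases lt_factor_iff.mp hlt with ⟨hnm, heq⟩ | ⟨t, -, ht, h1⟩
    · obtain ⟨t, ht, h1⟩ := h'.2 n h.1 hnm
      exact ⟨n + t, ht, LtAt.of_prefix heq h1⟩
    · exact ⟨t, ht, h1⟩
  obtain ⟨t, ht, hL⟩ := key
  refine ⟨by have := h.1; omega, fun r h0 hr => ?_⟩
  rcases lt_trichotomy r n with hrn | rfl | hrn
  · obtain ⟨t, ht, h1⟩ := h.2 r h0 hrn
    exact ⟨t, by omega, h1⟩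
  · exact ⟨t, by omega, hL⟩
  · obtain ⟨t', ht', h1⟩ := h'.2 (r - n) (by omega) (by omega)
    rw [show p + n + (r - n) = p + r by omega] at h1
    exact ⟨_, by omega, hL.trans h1⟩

theorem LyndonAt.infLyndonAt {p n q : ℕ} (h : LyndonAt x p n) (hq : InfLyndonAt x q)
    (hqn : q ≤ p + n) (hlt : ∃ t, LtAt x p q t) : InfLyndonAt x p := by
  intro j hj
  rcases lt_trichotomy j q with hjq | rfl | hjq
  · obtain ⟨t, -, ht⟩ := h.2 (j - p) (by omega) (by omega)
    rw [show p + (j - p) = j by omega] at ht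
    exact ⟨t, ht⟩
  · exact hlt
  · obtain ⟨t, ht⟩ := hlt
    obtain ⟨t', ht'⟩ := hq j hjq
    exact ⟨_, ht.trans ht'⟩

/-! ### Lyndon factorizations of infinite words -/

/-- Take the longest Lyndon factor at p. If it crossed i, the suffix at p would itself be Lyndon by
`LyndonAt.infLyndonAt`, against minimality of i. -/
theorem exists_factorization_of_infLyndonAt {i : ℕ} (hi : InfLyndonAt x i)
    (hmin : ∀ p < i, ¬ InfLyndonAt x p) (l p : ℕ) (hl : p + l = i) :
    ∃ ws : List (List Γ), (∀ w ∈ ws, IsLyndon w) ∧ ws.Pairwise (fun u v => v ≤ u) ∧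
      (∀ w ∈ ws, StrictLt (factor x i w.length) w) ∧ ws.flatten = factor x p l := by
  induction l using Nat.strong_induction_on generalizing p with
  | _ l ih =>
    rcases Nat.eq_zero_or_pos l with rfl | hlpos
    · exact ⟨[], by simp, by simp, by simp, by simp [factor]⟩
    have hp : ¬ InfLyndonAt x p := hmin p (by omega)
    obtain ⟨n, hn, hmax⟩ := exists_max_lyndonAt hp
    have hnpos := hn.1
    have hnl : n ≤ l := by
      by_contra! hcon
      obtain ⟨t, -, ht⟩ := hn.2 l hlpos hcon
      rw [hl] at ht
      exact hp (hn.infLyndonAt hi (by omega) ⟨t, ht⟩)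
    obtain ⟨ws, h1, h2, h3, h4⟩ := ih (l - n) (by omega) (p + n) (by omega)
    have hle : ∀ v ∈ ws, v ≤ factor x p n := by
      cases ws with
      | nil => simp
      | cons v ws =>
        have hv : v = factor x (p + n) v.length :=
          (eq_factor_of_append_eq_factor (u := v) (v := ws.flatten) (by simpa using h4)).1
        have hvle : v ≤ factor x p n := by
          by_contra! hcon
          have hvL := h1 v (by simp)
          rw [hv] at hcon hvL
          rw [isLyndon_factor_iff] at hvL
          exact hmax (n + v.length) (by have := hvL.1; omega) (hn.append hvL hcon)
        intro u hu
        rcases List.mem_cons.mp hu with rfl | hu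
        · exact hvle
        · exact (List.rel_of_pairwise_cons h2 hu).trans hvle
    have hlast : StrictLt (factor x i n) (factor x p n) := by
      cases ws with
      | nil =>
        have hln : l = n := by
          have := congrArg List.length h4
          simp at this
          omega
        subst hln
        rw [strictLt_factor_iff]
        rcases ltAt_trichotomy x p i l with ⟨t, -, h⟩ | ⟨t, ht, h⟩ | h
        · exact absurd (hn.infLyndonAt hi (by omega) ⟨t, h⟩) hp
        · exact ⟨t, ht, ht, h⟩
        -- Here the Lyndon tail at i starts with the last factor. Removing that factor from both
        -- suffixes compares i with i + l, which would make the suffix at p smaller than the one at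
        -- i.
        · obtain ⟨t, ht⟩ := hi (i + l) (by omega)
          rw [← hl] at ht h hi
          exact absurd (hn.infLyndonAt hi (by omega) ⟨_, LtAt.of_prefix h ht⟩) hp
      | cons v ws =>
        have hv := h3 v (by simp)
        have hvle := hle v (by simp)
        rcases hvle.lt_or_eq with hlt | heq
        · have hvf : v = factor x (p + n) v.length :=
            (eq_factor_of_append_eq_factor (u := v) (v := ws.flatten) (by simpa using h4)).1
          rw [hvf] at hv hlt
          rw [length_factor, strictLt_factor_iff] at hv
          rw [strictLt_factor_iff]
          obtain ⟨t, ht, -, hv⟩ := hv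
          -- The tail is below the next factor v by a letter, and v is below the current factor. If
          -- v is a prefix of it the same letter decides, otherwise transitivity does.
          rcases lt_factor_iff.mp hlt with ⟨hvn, heq⟩ | ⟨t', ht', htn, hlt⟩
          · refine ⟨t, by omega, by omega, fun s hs => ?_, ?_⟩
            · rw [hv.1 s hs, heq s (by omega)]
            · rw [← heq t ht]
              exact hv.2
          · exact ⟨_, by omega, by omega, hv.trans hlt⟩
        · have hlen : v.length = n := by rw [heq]; simp
          rw [hlen, heq] at hv
          exact hv
    refine ⟨factor x p n :: ws, ?_, ?_, ?_, ?_⟩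
    · intro w hw
      rcases List.mem_cons.mp hw with rfl | hw
      · exact isLyndon_factor_iff.mpr hn
      · exact h1 w hw
    · exact List.pairwise_cons.mpr ⟨hle, h2⟩
    · intro w hw
      rcases List.mem_cons.mp hw with rfl | hw
      · rwa [length_factor]
      · exact h3 w hw
    · rw [List.flatten_cons, h4, ← factor_add]
      congr 1
      omega

theorem hasFiniteLyndonFactorization_iff :
    HasFiniteLyndonFactorization x ↔ ∃ i, InfLyndonAt x i := by
  classical
  constructor
  · rintro ⟨ws, y, -, hy, -, -, -, rfl⟩
    exact ⟨_, isInfLyndon_infSuffix_iff.mp hy⟩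
  · intro h
    obtain ⟨ws, h1, h2, h3, h4⟩ := exists_factorization_of_infLyndonAt (Nat.find_spec h)
      (fun p hp => Nat.find_min h hp) (Nat.find h) 0 (by omega)
    refine ⟨ws, infSuffix x (Nat.find h), h1, isInfLyndon_infSuffix_iff.mpr (Nat.find_spec h),
      h2, fun w hw => ?_, ?_, ?_⟩
    · obtain ⟨t, _, ht, heq, hlt⟩ := h3 w hw
      exact ⟨t, ht, fun i hi => by simpa [infSuffix] using heq i hi,
        by simpa [infSuffix] using hlt⟩
    · rw [h4]
      exact isPrefixOf_factor _ _
    · rw [h4, length_factor]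

theorem hasInfiniteLyndonFactorization_of_forall (h : ∀ i, ¬ InfLyndonAt x i) :
    HasInfiniteLyndonFactorization x := by
  choose len hlen hmax using fun p => exists_max_lyndonAt (h p)
  let P : ℕ → ℕ := fun n => Nat.rec 0 (fun _ p => p + len p) n
  have hP : ∀ n, P (n + 1) = P n + len (P n) := fun n => rfl
  refine ⟨fun n => factor x (P n) (len (P n)), fun n => isLyndon_factor_iff.mpr (hlen _),
    fun n => ?_, fun n => ?_⟩
  · by_contra! hcon
    rw [hP] at hcon
    exact hmax (P n) _ (by have := (hlen (P n + len (P n))).1; omega)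
      ((hlen (P n)).append (hlen _) hcon)
  · have hflat : ((List.range n).map fun n => factor x (P n) (len (P n))).flatten =
        factor x 0 (P n) := by
      induction n with
      | zero => simp [factor, P]
      | succ n ih =>
        rw [List.range_succ, List.map_append, List.flatten_append, ih, hP, factor_add]
        simp
    rw [hflat]
    exact isPrefixOf_factor _ _

/-- Factor b is at most factor n, hence at most the rest of factor n from i on. Either a letter
makes the suffix at `P b` smaller, or factor b is a prefix of that rest; removing it from both
suffixes lowers t, so induction applies. -/
theorem not_ltAt_of_factorization {P len : ℕ → ℕ} (hP : ∀ n, P (n + 1) = P n + len n)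
    (hL : ∀ n, LyndonAt x (P n) (len n))
    (hmono : ∀ n b, n ≤ b → factor x (P b) (len b) ≤ factor x (P n) (len n))
    (t i n b : ℕ) (hi : P n ≤ i) (hi' : i < P (n + 1)) (hb : n ≤ b) : ¬ LtAt x i (P b) t := by
  induction t using Nat.strong_induction_on generalizing i n b with
  | _ t ih =>
    intro hlt
    have hle : factor x (P b) (len b) ≤ factor x i (P (n + 1) - i) := by
      refine (hmono n b hb).trans ?_
      rcases hi.eq_or_lt with rfl | hi
      · rw [hP, Nat.add_sub_cancel_left]
      · obtain ⟨t, ht, h⟩ := (hL n).2 (i - P n) (by omega) (by rw [hP] at hi'; omega)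
        rw [show P n + (i - P n) = i by omega] at h
        exact (strictLt_factor_iff.mpr ⟨t, by omega, by rw [hP]; omega, h⟩).lt.le
    have hcase : (len b ≤ P (n + 1) - i ∧ ∀ s < len b, x (P b + s) = x (i + s)) ∨
        ∃ t, LtAt x (P b) i t := by
      rcases hle.lt_or_eq with h | h
      · rcases lt_factor_iff.mp h with ⟨h1, h2⟩ | ⟨t, -, -, h⟩
        · exact Or.inl ⟨h1.le, h2⟩
        · exact Or.inr ⟨t, h⟩
      · have hl : len b = P (n + 1) - i := by simpa using congrArg List.length h
        refine Or.inl ⟨hl.le, fun s hs => ?_⟩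
        have h1 : (factor x (P b) (len b))[s]'(by simpa using hs) =
            (factor x i (P (n + 1) - i))[s]'(by simp; omega) := by
          simp only [h]
        simpa using h1
    rcases hcase with ⟨hl, heq⟩ | ⟨t', h⟩
    · have hpos := (hL b).1
      have ht : len b ≤ t := by
        by_contra! hcon
        exact hlt.2.ne (heq t hcon).symm
      have hlt' : LtAt x (i + len b) (P (b + 1)) (t - len b) := by
        rw [hP b]
        refine ⟨fun s hs => ?_, ?_⟩
        · rw [add_assoc, add_assoc]
          exact hlt.1 _ (by omega)
        · rw [add_assoc, add_assoc, Nat.add_sub_cancel' ht]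
          exact hlt.2
      rcases lt_or_ge (i + len b) (P (n + 1)) with hc | hc
      · exact ih _ (by omega) (i + len b) n (b + 1) (by omega) hc (by omega) hlt'
      -- Factor n is now used up exactly, so the left position moves to the start of factor n + 1.
      · refine ih _ (by omega) (i + len b) (n + 1) (b + 1) hc ?_ (by omega) hlt'
        have := (hL (n + 1)).1
        rw [hP (n + 1)]
        omega
    · exact hlt.asymm h

theorem HasInfiniteLyndonFactorization.not_infLyndonAt (h : HasInfiniteLyndonFactorization x)
    (i : ℕ) : ¬ InfLyndonAt x i := by
  obtain ⟨w, hw, hmono, hpre⟩ := h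
  let P : ℕ → ℕ := fun n => ((List.range n).map w).flatten.length
  have hsucc : ∀ n, ((List.range (n + 1)).map w).flatten =
      ((List.range n).map w).flatten ++ w n := by
    intro n
    rw [List.range_succ, List.map_append, List.flatten_append]
    simp
  have hP : ∀ n, P (n + 1) = P n + (w n).length := by
    intro n
    simp only [P]
    rw [hsucc, List.length_append]
  have hwf : ∀ n, w n = factor x (P n) (w n).length := by
    intro n
    have h1 : ((List.range (n + 1)).map w).flatten = factor x 0 (P (n + 1)) := by
      apply List.ext_getElem (by simp [P])
      intro j h1 h2
      simpa using (hpre (n + 1) j h1).symm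
    rw [hsucc] at h1
    have h2 := (eq_factor_of_append_eq_factor h1).2
    rwa [zero_add] at h2
  have hL : ∀ n, LyndonAt x (P n) (w n).length := by
    intro n
    rw [← isLyndon_factor_iff, ← hwf]
    exact hw n
  have hmono' : ∀ n b, n ≤ b →
      factor x (P b) (w b).length ≤ factor x (P n) (w n).length := by
    intro n b hnb
    rw [← hwf, ← hwf]
    exact antitone_nat_of_succ_le hmono hnb
  have hge : ∀ n, n ≤ P n := by
    intro n
    induction n with
    | zero => simp
    | succ n ih => have := (hL n).1; rw [hP]; omega
  have hex : ∃ n, i < P n := ⟨i + 1, hge (i + 1)⟩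
  intro hi
  obtain ⟨n, hn⟩ : ∃ n, Nat.find hex = n + 1 := by
    refine Nat.exists_eq_succ_of_ne_zero fun h0 => ?_
    have := Nat.find_spec hex
    rw [h0] at this
    simp [P] at this
  have h1 : i < P (n + 1) := hn ▸ Nat.find_spec hex
  have h2 : P n ≤ i := not_lt.mp (Nat.find_min hex (by omega))
  obtain ⟨t, ht⟩ := hi _ h1
  -- The suffix at i, inside factor n, is not smaller than the suffix at the start of factor n + 1.
  exact not_ltAt_of_factorization hP hL hmono' t i n (n + 1) h2 h1 (by omega) ht

theorem hasInfiniteLyndonFactorization_iff :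
    HasInfiniteLyndonFactorization x ↔ ¬ ∃ i, InfLyndonAt x i :=
  ⟨fun h ⟨i, hi⟩ => h.not_infLyndonAt i hi,
    fun h => hasInfiniteLyndonFactorization_of_forall (not_exists.mp h)⟩

end Factors

end LyndonAutomatic

theorem theorem11 :
    ∃ A : LyndonAutomatic.Description → Bool, Computable A ∧
      ∀ (k m s : ℕ), 2 ≤ k →
        ∀ (M : LyndonAutomatic.DFAO k m s) (x : ℕ → Fin s), M.Generates x →
          (A M.description = true ↔ LyndonAutomatic.HasFiniteLyndonFactorization x) ∧
          (A M.description = false ↔ LyndonAutomatic.HasInfiniteLyndonFactorization x) := by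
  -- The unnamed component is the decision procedure attached to the primitive recursive predicate;
  -- A is its `decide`.
  obtain ⟨_, hA⟩ := LyndonAutomatic.primrecPred_hasLyndonSuffix
  refine ⟨_, hA.to_comp, fun k m s hk M x hM => ?_⟩
  rw [LyndonAutomatic.hasFiniteLyndonFactorization_iff,
    LyndonAutomatic.hasInfiniteLyndonFactorization_iff, decide_eq_true_iff, decide_eq_false_iff_not,
    hM.hasLyndonSuffix_iff hk]
  exact ⟨Iff.rfl, Iff.rfl⟩
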